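/- \textbf{Setting.} Fix finite ranked alphabets of nonterminals and of terminals and a countably infinite set $\mathbb X$ of nodes. A literal is $a(x_1,\dots,x_k)$ with $a$ a symbol of arity $k$ and $x_i\in\mathbb X$; a graph is a finite sequence of literals; $X(\cdot)$ is the set of nodes occurring in a literal or graph; $\varepsilon$ is the empty graph; $g\bowtie h$ means that $g$ is a permutation of $h$. Let $\Gamma$ be a hyperedge replacement grammar: a finite set of rules $A\to\varrho$ ($A$ a nonterminal literal, $\varrho$ a graph) and a start literal $Z$. It is augmented by $\mathit{Start}\to Z$. For a partial function $\sigma$ on nodes defined on $X(e)$, $e^\sigma$ is the literal obtained by replacing each node by its image. Let $\iota$ be the partial identity on $X(Z)$. \textbf{dCFA.} An item is a pair $(A\to\alpha\cdot\beta,\sigma)$, $\sigma$ a partial function from nodes of the rule to \emph{parameters}; $\mathit{params}(Q)$ is the set of all parameters in the images of the $\sigma$ of a set $Q$ of items. The closure of $Q$ adds, for each $(C\to\alpha\cdot B\beta,\sigma)$ in it with $B$ a nonterminal literal, each rule $A\to\varrho$ and each bijection $\kappa:X(A)\to X(B)$ with $A^\kappa=B$, the item $(A\to\cdot\varrho,\sigma\circ\kappa)$.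 For a literal $e$, $\mathit{goto}(Q,e)$ consists of all $(A\to\alpha e_0\cdot\beta,\sigma')$ with $(A\to\alpha\cdot e_0\beta,\sigma)\in Q$, where $\sigma'$ is injective and extends $\sigma$ by exactly the nodes of $e_0$, the newly bound nodes are mapped outside $\mathit{params}(Q)$, and $e_0^{\sigma'}=e$. A dCFA of $\Gamma$ has as initial state $Q_0$ the closure of $\{(\mathit{Start}\to\cdot Z,\iota)\}$; for each state $Q$ and each $e$ with $\mathit{goto}(Q,e)\ne\varnothing$ it has, up to injective renaming of the nodes of $e$ outside $\mathit{params}(Q)$, exactly one transition $Q\xrightarrow{(e,\mu)}Q'$, where $\mu$ is an injective function on $\mathit{params}(Q')$ such that renaming the parameters of $Q'$ by $\mu$ yields the closure of $\mathit{goto}(Q,e)$; there are no other transitions, and all states are reachable from $Q_0$. (States differing only by names of parameters may thus be identified.) The state containing the accept item $(\mathit{Start}\to Z\,\cdot\,,\sigma)$, where $\sigma$ is $\iota$ up to the names of parameters, is called $Q_A$. \textbf{ASR parser.} $Q^\tau$ denotes a state with an input binding $\tau:\mathit{params}(Q)\to\mathbb X$. The transition $Q\xrightarrow{(e,\mu)}Q'$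 leads from $Q^\tau$ under a literal $\bar e$ to $Q'^{\,\nu\circ\mu}$ if $\nu:\mathit{params}(Q)\cup X(e)\to\mathbb X$ is injective, extends $\tau$, and $e^\nu=\bar e$; the nodes $\nu(x)$ with $x\in X(e)\setminus\mathit{params}(Q)$ are its new nodes. A stack $S=Q_0^\iota e_1Q_1^{\tau_1}\cdots e_nQ_n^{\tau_n}$ has top $Q_n^{\tau_n}$ and graph $e_1\cdots e_n$. A configuration $(S,g)$ consists of a stack and the terminal graph $g$ processed so far. The triggers of $Q$ are its reduce items $(A\to\varrho\,\cdot\,,\sigma)\in Q$ and the transitions leaving $Q$ under terminal literals. Let $S$ have top $Q^\tau$. A shift move $(S,g)\vdash_t(S\bar eQ'^{\tau'},g\bar e)$ is caused by a transition $t$ leading from $Q^\tau$ under the terminal literal $\bar e$ to $Q'^{\tau'}$ with no new node occurring in $g$ or in the graph of $S$. A reduce move $(S,g)\vdash_t(S'A^{\tau\circ\sigma}Q'^{\tau'},g)$ is caused by a reduce item $t=(A\to\varrho\,\cdot\,,\sigma)$ other than the accept item, where $S'$ arises from $S$ by popping $|\varrho|$ literals, which form $\varrho^{\tau\circ\sigma}$,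 $\tau\circ\sigma$ is defined on $X(A)$, and a transition leads from the top of $S'$ under $A^{\tau\circ\sigma}$ to $Q'^{\tau'}$ with no new node in the graph of $S'$. Let $\vdash$ be the union of the relations $\vdash_t$. A configuration is reached if $(Q_0^\iota,\varepsilon)\vdash^*(S,g)$, and accepting if the state on top of $S$ is $Q_A$. \textbf{Follow sets.} For a trigger $t$ of $Q$, $\mathit{Success}(Q^\tau,g',t)$ is the set of graphs $v$ such that, for some reached $(S,g')$ with top $Q^\tau$, $(S,g')\vdash_t c\vdash^*(S_A,g'v)$ for some $c$ and some accepting $(S_A,g'v)$, or $t$ is the accept item and $v=\varepsilon$. $\mathit{First}(h)$ is the first literal of $h$, $\mathit{Any}(h)$ the set of literals of $h$; $\mathit{First}(\varepsilon)=\$$, $\mathit{Any}(\varepsilon)=\{\$\}$. $f_Q^{\tau,g'}$ maps a node $x$ to $y\in\mathit{params}(Q)$ if $\tau(y)=x$, otherwise to $-$ if $x\notin X(g')$, otherwise to $\bullet$; applied to literals it yields pseudo-literals, and it maps $\$$ to $\$$. $\mathit{Follow}(Q,t)$ is the union over all $\tau,g'$ of $f_Q^{\tau,g'}(\mathit{First}(\mathit{Success}(Q^\tau,g',t)))$,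 and $\mathit{Follow}^*(Q,t)$ is defined likewise with $\mathit{Any}$. For triggers $t\neq t'$ of $Q$, $t\prec t'$ means $\mathit{Follow}^*(Q,t)\cap\mathit{Follow}(Q,t')\neq\varnothing$; $Q$ is conflict-free if there is no cycle $t_1\prec\cdots\prec t_k\prec t_1$ of triggers of $Q$. \textbf{SelectTrigger}$(Q,\tau,g'')$ uses, for each $Q$, a sequence $t_1,\dots,t_n$ of all triggers of $Q$ without repetition such that $\mathit{Follow}(Q,t_i)\cap\mathit{Follow}^*(Q,t_j)=\varnothing$ for $i<j$. For $i=1,\dots,n$: if $g''\neq\varepsilon$ and some literal $e$ of $g''$ fits some pseudo-literal $\ell\in\mathit{Follow}(Q,t_i)$, it returns $(t_i,e)$ for any such $e$; if $g''=\varepsilon$ and $\$\in\mathit{Follow}(Q,t_i)$, it returns $(t_i,\$)$. If the loop ends, it returns failure. Here $a(x_1,\dots,x_k)$ fits $a(y_1,\dots,y_k)$ if $x_i=\tau(y_i)$ whenever $y_i\in\mathit{params}(Q)$. \textbf{Free edge choice property.} For every reached $(S,g')$ with top $Q^\tau$ and every $g''\neq\varepsilon$ such that $(S,g')\vdash^*(S_A,g'g'')$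 for an accepting configuration, each possible return value $(t,e)$ of $\mathrm{SelectTrigger}(Q,\tau,g'')$ satisfies: (i) $f_Q^{\tau,g'}(e)\in\mathit{Follow}(Q,t)$; (ii) if $(S,g')\vdash_t(S',g'e')\vdash^*(S_A,g'e'h')$ for some $S'$, some accepting configuration and some $e'h'\bowtie g''$, then also $(S,g')\vdash_t(S',g'e)\vdash^*(S_A,g'eh)$ for some $S'$, some accepting configuration and some $eh\bowtie g''$. \textbf{Lemma.} Let every state of the dCFA be conflict-free. Then sequences of triggers as required by SelectTrigger exist for all states. Moreover, for any choice of these sequences for which the free edge choice property holds, the following is true. Let $(S,g')$ be reached by the ASR parser with top $Q^\tau$, and let $g''$ be a terminal graph with $(S,g')\vdash^*(S_A,g'g'')$, where $(S_A,g'g'')$ is accepting. Then $\mathrm{SelectTrigger}(Q,\tau,g'')$ returns a value, and each value that it may return is a pair $(t,e)$, not failure, where $t$ is a trigger of $Q$ and: \begin{itemize} \item if $t$ is the accept item, then $S=S_A$, $e=\$$ and $g''=\varepsilon$; \item if $t$ is any other reduce item, then $(S,g')\vdash_t(S',g')\vdash^*(S_A,g'g'')$ for some stack $S'$, and $g''=\varepsilon$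 iff $e=\$$; \item if $t$ is a transition, then $e$ is a literal of $g''$ and $(S,g')\vdash_t(S\,e\,Q'^{\tau'},g'e)\vdash^*(S_A,g'eh)$ for some $Q'^{\tau'}$ and some graph $h$ with $g''\bowtie eh$. \end{itemize} -/

import Mathlib

namespace PSR

/-! ### Literals, graphs, bindings -/

/-- A literal `a(x₁, …, xₖ)` over a ranked alphabet `L` with arity function `ar`. -/
structure Lit {L : Type*} (ar : L → ℕ) (X : Type*) where
  lab : L
  args : Fin (ar lab) → X

/-- Apply a function to the attached nodes of a literal. -/
def Lit.map {L X Y : Type*} {ar : L → ℕ} (f : X → Y) (e : Lit ar X) : Lit ar Y :=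
  ⟨e.lab, fun i => f (e.args i)⟩

/-- `X(e)`: the nodes of a literal. -/
def Lit.nodes {L X : Type*} {ar : L → ℕ} (e : Lit ar X) : Set X := Set.range e.args

/-- `X(g)`: the nodes of a graph, a graph being a finite sequence of literals. -/
def gNodes {L X : Type*} {ar : L → ℕ} (g : List (Lit ar X)) : Set X :=
  {x | ∃ e ∈ g, x ∈ e.nodes}

/-- The arity function on all symbols, nonterminal (`inl`) or terminal (`inr`). -/
def arity {N T : Type*} (arN : N → ℕ) (arT : T → ℕ) : N ⊕ T → ℕ
  | Sum.inl A => arN A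
  | Sum.inr a => arT a

/-- A nonterminal literal, seen as a literal over all symbols. -/
def Lit.ofN {N T X : Type*} {arN : N → ℕ} {arT : T → ℕ} (A : Lit arN X) :
    Lit (arity arN arT) X := ⟨Sum.inl A.lab, A.args⟩

/-- A terminal literal, seen as a literal over all symbols. -/
def Lit.ofT {N T X : Type*} {arN : N → ℕ} {arT : T → ℕ} (a : Lit arT X) :
    Lit (arity arN arT) X := ⟨Sum.inr a.lab, a.args⟩

/-- A partial function on nodes (`none` means undefined). -/
abbrev Bind (X : Type*) := X → Option X

/-- Injectivity of a partial function on its domain. -/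
def Bind.Inj {X : Type*} (σ : Bind X) : Prop :=
  ∀ x y z, σ x = some z → σ y = some z → x = y

/-- Composition `τ ∘ σ` of partial functions. -/
def Bind.after {X : Type*} (τ σ : Bind X) : Bind X := fun x => (σ x).bind τ

/-- `e^σ = e'`: the partial function `σ` is defined on all nodes of `e`, and replacing them by
their images yields `e'`. -/
def Lit.Inst {L X : Type*} {ar : L → ℕ} (e : Lit ar X) (σ : Bind X) (e' : Lit ar X) : Prop :=
  e.map σ = e'.map some

/-! ### Hyperedge replacement grammars -/

/-- A rule `A → ϱ`. -/
structure Rule {N T : Type*} (arN : N → ℕ) (arT : T → ℕ) (X : Type*) where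
  lhs : Lit arN X
  rhs : List (Lit (arity arN arT) X)

/-- A hyperedge replacement grammar: a finite set of rules and a start literal `Z`. -/
structure HRGrammar {N T : Type*} (arN : N → ℕ) (arT : T → ℕ) (X : Type*) where
  rules : Finset (Rule arN arT X)
  start : Lit arN X

section

variable {N T X : Type*} {arN : N → ℕ} {arT : T → ℕ}

/-- An item `(A → α · β, σ)`. The production `none` is the augmenting production `Start → Z`;
`pos` is the length of `α`; the partial function `σ` binds rule nodes to parameters. -/
structure Item {N T : Type*} (arN : N → ℕ) (arT : T → ℕ) (X : Type*) where
  prod : Option (Rule arN arT X)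
  pos : ℕ
  bind : Bind X

/-- The right-hand side of a production, `none` being `Start → Z`. -/
def HRGrammar.rhs (Γ : HRGrammar arN arT X) :
    Option (Rule arN arT X) → List (Lit (arity arN arT) X)
  | none => [Γ.start.ofN]
  | some r => r.rhs

/-- The literal behind the dot of an item. -/
def HRGrammar.next (Γ : HRGrammar arN arT X) (it : Item arN arT X) :
    Option (Lit (arity arN arT) X) := (Γ.rhs it.prod)[it.pos]?

/-- The parameters of a set of items: all nodes to which rule nodes are bound. -/
def params (Q : Set (Item arN arT X)) : Set X :=
  {y | ∃ it ∈ Q, ∃ x, it.bind x = some y}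

/-- Renaming of the parameters of an item. -/
def Item.rename (μ : Bind X) (it : Item arN arT X) : Item arN arT X :=
  ⟨it.prod, it.pos, Bind.after μ it.bind⟩

/-- The closure of a set of items: an item `(C → α · B β, σ)` calls every rule `A → ϱ` whose
left-hand side equals `B` up to a bijective renaming `κ` of nodes; those nodes of `A` are bound that
correspond to nodes of `B` bound by `σ`. -/
inductive HRGrammar.closure (Γ : HRGrammar arN arT X) (K : Set (Item arN arT X)) :
    Set (Item arN arT X)
  | base (it : Item arN arT X) : it ∈ K → HRGrammar.closure Γ K it
  | call (it : Item arN arT X) (B : Lit arN X) (r : Rule arN arT X) (κ : Bind X) :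
      HRGrammar.closure Γ K it → Γ.next it = some B.ofN → r ∈ Γ.rules → κ.Inj →
      (∀ x, (κ x).isSome ↔ x ∈ r.lhs.nodes) → r.lhs.Inst κ B →
      HRGrammar.closure Γ K ⟨some r, 0, Bind.after it.bind κ⟩

/-- Moving the dot of the items in `Q` over the literal `e`: nodes of the literal behind the dot
that are bound must be attached to the corresponding parameters in `e`, and unbound nodes become
bound to pairwise distinct nodes of `e` that are not parameters of `Q`. -/
def HRGrammar.goto (Γ : HRGrammar arN arT X) (Q : Set (Item arN arT X))
    (e : Lit (arity arN arT) X) : Set (Item arN arT X) :=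
  {it' | ∃ it ∈ Q, ∃ e₀, Γ.next it = some e₀ ∧ ∃ σ' : Bind X,
      σ'.Inj ∧
      (∀ x, (σ' x).isSome ↔ ((it.bind x).isSome ∨ x ∈ e₀.nodes)) ∧
      (∀ x y, it.bind x = some y → σ' x = some y) ∧
      (∀ x ∈ e₀.nodes, it.bind x = none → ∀ y, σ' x = some y → y ∉ params Q) ∧
      e₀.Inst σ' e ∧
      it' = ⟨it.prod, it.pos + 1, σ'⟩}

open Classical in
/-- The partial identity `ι` on the nodes of the start literal (the empty function if the start
literal has no nodes). -/
noncomputable def HRGrammar.iota (Γ : HRGrammar arN arT X) : Bind X :=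
  fun x => if x ∈ Γ.start.nodes then some x else none

/-! ### The deterministic characteristic finite automaton -/

/-- A state of the automaton is a finite set of items. -/
abbrev State {N T : Type*} (arN : N → ℕ) (arT : T → ℕ) (X : Type*) := Finset (Item arN arT X)

/-- A transition `src —(lit, ren)→ tgt`. -/
structure Transition {N T : Type*} (arN : N → ℕ) (arT : T → ℕ) (X : Type*) where
  src : State arN arT X
  lit : Lit (arity arN arT) X
  ren : Bind X
  tgt : State arN arT X

/-- Two labels are the same for `Q` if they differ only in the names of nodes that are not
parameters of `Q`. -/
def SameLabel (Q : State arN arT X) (e e' : Lit (arity arN arT) X) : Prop :=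
  ∃ ρ : X → X, Set.InjOn ρ (params (Q : Set (Item arN arT X)) ∪ e.nodes) ∧
    (∀ y ∈ params (Q : Set (Item arN arT X)), ρ y = y) ∧ e.map ρ = e'

/-- A dCFA of `Γ`, obtained by the powerset construction, where states that differ only in the names
of their parameters may be identified; the component `ren` of a transition records how the
parameters of its target are to be renamed. -/
structure DCFA (Γ : HRGrammar arN arT X) where
  states : Set (State arN arT X)
  init : State arN arT X
  trans : Set (Transition arN arT X)
  init_eq : (init : Set (Item arN arT X)) = Γ.closure {⟨none, 0, Γ.iota⟩}
  states_eq : ∀ Q, Q ∈ states ↔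
    Relation.ReflTransGen (fun P P' => ∃ tr ∈ trans, tr.src = P ∧ tr.tgt = P') init Q
  trans_src : ∀ tr ∈ trans, tr.src ∈ states
  /-- Up to the names of new nodes, there is one transition for every possible label. -/
  trans_exists : ∀ Q ∈ states, ∀ e, (Γ.goto Q e).Nonempty →
    ∃ tr ∈ trans, tr.src = Q ∧ SameLabel Q e tr.lit
  trans_unique : ∀ tr ∈ trans, ∀ tr' ∈ trans, tr.src = tr'.src →
    SameLabel tr.src tr.lit tr'.lit → tr = tr'
  trans_nonempty : ∀ tr ∈ trans, (Γ.goto tr.src tr.lit).Nonempty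
  ren_inj : ∀ tr ∈ trans, tr.ren.Inj
  ren_dom : ∀ tr ∈ trans, ∀ y,
    (tr.ren y).isSome ↔ y ∈ params (tr.tgt : Set (Item arN arT X))
  tgt_eq : ∀ tr ∈ trans,
    Item.rename tr.ren '' (tr.tgt : Set (Item arN arT X)) = Γ.closure (Γ.goto tr.src tr.lit)

variable {Γ : HRGrammar arN arT X}

/-- `Q^τ`: a state together with an input binding of its parameters. -/
abbrev BState {N T : Type*} (arN : N → ℕ) (arT : T → ℕ) (X : Type*) := State arN arT X × Bind X

/-- The dCFA step from `Q^τ` to `Q'^{τ'}` induced by the transition `tr` when reading the literal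
`e`; nodes of `tr.lit` that are not parameters of `Q` must be matched by nodes outside `W`. -/
def DCFA.Step (D : DCFA Γ) (W : Set X) (q : BState arN arT X) (tr : Transition arN arT X)
    (e : Lit (arity arN arT) X) (q' : BState arN arT X) : Prop :=
  tr ∈ D.trans ∧ tr.src = q.1 ∧ tr.tgt = q'.1 ∧
  ∃ ν : Bind X, ν.Inj ∧
    (∀ x, (ν x).isSome ↔ (x ∈ params (q.1 : Set (Item arN arT X)) ∨ x ∈ tr.lit.nodes)) ∧
    (∀ x ∈ params (q.1 : Set (Item arN arT X)), ν x = q.2 x) ∧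
    (∀ x ∈ tr.lit.nodes, x ∉ params (q.1 : Set (Item arN arT X)) →
      ∀ z, ν x = some z → z ∉ W) ∧
    tr.lit.Inst ν e ∧
    q'.2 = Bind.after ν tr.ren

/-! ### The ASR parser -/

/-- A stack `Q₀^ι e₁ Q₁^{τ₁} ⋯ eₙ Qₙ^{τₙ}`, given as the list of the pairs `(eᵢ, Qᵢ^{τᵢ})` with the
last one first; the bottom element `Q₀^ι` is implicit. -/
abbrev Stack {N T : Type*} (arN : N → ℕ) (arT : T → ℕ) (X : Type*) :=
  List (Lit (arity arN arT) X × BState arN arT X)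

/-- A configuration: a stack and the graph read so far. -/
abbrev Config {N T : Type*} (arN : N → ℕ) (arT : T → ℕ) (X : Type*) :=
  Stack arN arT X × List (Lit arT X)

/-- The top `Q^τ` of a stack. -/
noncomputable def DCFA.top (D : DCFA Γ) : Stack arN arT X → BState arN arT X
  | [] => (D.init, Γ.iota)
  | p :: _ => p.2

/-- The sequence `e₁ ⋯ eₙ` of literals on a stack. -/
def Stack.graph (S : Stack arN arT X) : List (Lit (arity arN arT) X) := (S.map Prod.fst).reverse

/-- Triggers: transitions and reduce items. -/
inductive Trigger {N T : Type*} (arN : N → ℕ) (arT : T → ℕ) (X : Type*)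
  | shift (tr : Transition arN arT X)
  | reduce (it : Item arN arT X)

/-- The triggers of a state `Q`: the transitions leaving `Q` under a terminal literal, and the items
in `Q` with the dot at the end. -/
def DCFA.IsTrigger (D : DCFA Γ) (Q : State arN arT X) : Trigger arN arT X → Prop
  | .shift tr => tr ∈ D.trans ∧ tr.src = Q ∧ ∃ a : Lit arT X, tr.lit = a.ofT
  | .reduce it => it ∈ Q ∧ it.pos = (Γ.rhs it.prod).length

/-- The moves of the ASR parser, labelled by the triggers that cause them. The accept item
`Start → Z ·` causes no move. -/
inductive DCFA.Move (D : DCFA Γ) :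
    Trigger arN arT X → Config arN arT X → Config arN arT X → Prop
  | shift (S : Stack arN arT X) (g : List (Lit arT X)) (tr : Transition arN arT X)
      (e : Lit arT X) (q : BState arN arT X) :
      D.Step (gNodes S.graph ∪ gNodes g) (D.top S) tr e.ofT q →
      DCFA.Move D (.shift tr) (S, g) ((e.ofT, q) :: S, g ++ [e])
  | reduce (S popped S' : Stack arN arT X) (g : List (Lit arT X)) (r : Rule arN arT X)
      (σ : Bind X) (A : Lit arN X) (tr : Transition arN arT X) (q : BState arN arT X) :
      (⟨some r, r.rhs.length, σ⟩ : Item arN arT X) ∈ (D.top S).1 →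
      S = popped ++ S' →
      List.Forall₂ (fun e e' => e.Inst (Bind.after (D.top S).2 σ) e') r.rhs popped.graph →
      r.lhs.Inst (Bind.after (D.top S).2 σ) A →
      D.Step (gNodes S'.graph) (D.top S') tr A.ofN q →
      DCFA.Move D (.reduce ⟨some r, r.rhs.length, σ⟩) (S, g) ((A.ofN, q) :: S', g)

/-- Sequences of ASR moves. -/
def DCFA.Moves (D : DCFA Γ) : Config arN arT X → Config arN arT X → Prop :=
  Relation.ReflTransGen fun c c' => ∃ t, D.Move t c c'

/-- Configurations reached by the ASR parser. -/
def DCFA.Reached (D : DCFA Γ) (S : Stack arN arT X) (g : List (Lit arT X)) : Prop :=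
  D.Moves ([], []) (S, g)

/-- The reduce item `Start → Z ·` causing acceptance. -/
def Item.IsAccept (it : Item arN arT X) : Prop := it.prod = none ∧ it.pos = 1

/-- A stack is accepting if its top state is the accepting state `Q_A`, the (unique) one that
contains the accept item. -/
def DCFA.Accepting (D : DCFA Γ) (S : Stack arN arT X) : Prop := ∃ it ∈ (D.top S).1, it.IsAccept

/-! ### Successful sequences and follow sets -/

/-- The graphs processed by a successful sequence that is caused by the trigger `t` in a reached
configuration with top `Q^τ` and processed graph `g'`. The accept item causes acceptance at once. -/
def DCFA.Success (D : DCFA Γ) (Q : State arN arT X) (τ : Bind X) (g' : List (Lit arT X))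
    (t : Trigger arN arT X) : Set (List (Lit arT X)) :=
  {v | ∃ S, D.Reached S g' ∧ D.top S = (Q, τ) ∧ D.IsTrigger Q t ∧
    ((∃ it, t = .reduce it ∧ it.IsAccept ∧ v = []) ∨
      ∃ c S_A, D.Move t (S, g') c ∧ D.Moves c (S_A, g' ++ v) ∧ D.Accepting S_A)}

/-- The nodes of pseudo-literals: parameters, `–` (`new`) and `•` (`old`). -/
inductive PNode (X : Type*)
  | param (y : X)
  | new
  | old

open Classical in
/-- The function `f_Q^{τ,g'}` on nodes. -/
noncomputable def pnode (Q : State arN arT X) (τ : Bind X) (g' : List (Lit arT X)) (x : X) :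
    PNode X :=
  if h : ∃ y ∈ params (Q : Set (Item arN arT X)), τ y = some x then .param h.choose
  else if x ∉ gNodes g' then .new else .old

/-- The function `f_Q^{τ,g'}` on literals and on the symbol `$`, which is represented by `none`. -/
noncomputable def pseudo (Q : State arN arT X) (τ : Bind X) (g' : List (Lit arT X)) :
    Option (Lit arT X) → Option (Lit arT (PNode X)) :=
  Option.map (Lit.map (pnode Q τ g'))

/-- `First(h)`, where `none` stands for `$`. -/
def first (h : List (Lit arT X)) : Option (Lit arT X) := h.head?

/-- `Any(h)`, where `none` stands for `$`. -/
def any (h : List (Lit arT X)) : Set (Option (Lit arT X)) :=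
  {s | (h = [] ∧ s = none) ∨ ∃ e ∈ h, s = some e}

/-- `Follow(Q, t)`. -/
def DCFA.Follow (D : DCFA Γ) (Q : State arN arT X) (t : Trigger arN arT X) :
    Set (Option (Lit arT (PNode X))) :=
  {l | ∃ τ g', ∃ h ∈ D.Success Q τ g' t, l = pseudo Q τ g' (first h)}

/-- `Follow*(Q, t)`. -/
def DCFA.FollowStar (D : DCFA Γ) (Q : State arN arT X) (t : Trigger arN arT X) :
    Set (Option (Lit arT (PNode X))) :=
  {l | ∃ τ g', ∃ h ∈ D.Success Q τ g' t, ∃ s ∈ any h, l = pseudo Q τ g' s}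

/-! ### Conflict-freeness -/

/-- `t ≺ t'` for triggers of `Q`. -/
def DCFA.Prec (D : DCFA Γ) (Q : State arN arT X) (t t' : Trigger arN arT X) : Prop :=
  D.IsTrigger Q t ∧ D.IsTrigger Q t' ∧ t ≠ t' ∧ (D.FollowStar Q t ∩ D.Follow Q t').Nonempty

/-- A set of triggers is in conflict if it is `{t₁, …, tₖ}` for a cycle
`t₁ ≺ t₂ ≺ ⋯ ≺ tₖ ≺ t₁`. -/
def DCFA.InConflict (D : DCFA Γ) (Q : State arN arT X) (U : Set (Trigger arN arT X)) : Prop :=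
  ∃ t ts, U = {s | s ∈ t :: ts} ∧ List.IsChain (D.Prec Q) (t :: ts ++ [t])

/-- No set of triggers of `Q` is in conflict. -/
def DCFA.ConflictFree (D : DCFA Γ) (Q : State arN arT X) : Prop :=
  ¬ ∃ U : Set (Trigger arN arT X), (∀ t ∈ U, D.IsTrigger Q t) ∧ D.InConflict Q U

/-! ### The procedure `SelectTrigger` -/

/-- `ts` is a sequence of all triggers of `Q` with `Follow(Q, tᵢ) ∩ Follow*(Q, tⱼ) = ∅` for
`i < j`. -/
def DCFA.IsTriggerSeq (D : DCFA Γ) (Q : State arN arT X) (ts : List (Trigger arN arT X)) : Prop :=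
  ts.Nodup ∧ (∀ t, t ∈ ts ↔ D.IsTrigger Q t) ∧
    ts.Pairwise fun t t' => D.Follow Q t ∩ D.FollowStar Q t' = ∅

/-- The literal `e` fits the pseudo-literal `l` in `Q^τ`. -/
def Fits (Q : State arN arT X) (τ : Bind X) (e : Lit arT X) (l : Lit arT (PNode X)) : Prop :=
  ∃ a, ∃ x : Fin (arT a) → X, ∃ y : Fin (arT a) → PNode X, e = ⟨a, x⟩ ∧ l = ⟨a, y⟩ ∧
    ∀ i, ∀ p ∈ params (Q : Set (Item arN arT X)), y i = .param p → τ p = some (x i)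

/-- The loop of the procedure, over a list of triggers, as a relation between its inputs and its
possible return values: which of several fitting literals is returned is left open. A return value
is a pair of a trigger and a literal or `$` (`none`); the value `none` means failure. -/
inductive DCFA.Loop (D : DCFA Γ) (Q : State arN arT X) (τ : Bind X) (g : List (Lit arT X)) :
    List (Trigger arN arT X) → Option (Trigger arN arT X × Option (Lit arT X)) → Prop
  | failure : DCFA.Loop D Q τ g [] none
  | found (t : Trigger arN arT X) (ts : List (Trigger arN arT X)) (l : Lit arT (PNode X))
      (e : Lit arT X) :
      g ≠ [] → some l ∈ D.Follow Q t → e ∈ g → Fits Q τ e l →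
      DCFA.Loop D Q τ g (t :: ts) (some (t, some e))
  | eoi (t : Trigger arN arT X) (ts : List (Trigger arN arT X)) :
      g = [] → none ∈ D.Follow Q t → DCFA.Loop D Q τ g (t :: ts) (some (t, none))
  | next (t : Trigger arN arT X) (ts : List (Trigger arN arT X))
      (r : Option (Trigger arN arT X × Option (Lit arT X))) :
      (g ≠ [] → ¬ ∃ l, some l ∈ D.Follow Q t ∧ ∃ e ∈ g, Fits Q τ e l) →
      (g = [] → none ∉ D.Follow Q t) →
      DCFA.Loop D Q τ g ts r → DCFA.Loop D Q τ g (t :: ts) r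

/-- A choice, for every state, of the sequence of triggers used by the procedure. -/
def DCFA.IsTriggerOrder (D : DCFA Γ)
    (seq : State arN arT X → List (Trigger arN arT X)) : Prop :=
  ∀ Q ∈ D.states, D.IsTriggerSeq Q (seq Q)

/-- `SelectTrigger(Q, τ, g)`, run with the sequences of triggers given by `seq`, may return `r`. -/
def DCFA.SelectTrigger (D : DCFA Γ) (seq : State arN arT X → List (Trigger arN arT X))
    (Q : State arN arT X) (τ : Bind X) (g : List (Lit arT X))
    (r : Option (Trigger arN arT X × Option (Lit arT X))) : Prop :=
  D.Loop Q τ g (seq Q) r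

/-! ### The free edge choice property -/

/-- In the configuration `(S, g')`, the trigger `t` causes a move that reads `e`, and the parser can
then read `h` and accept. -/
def DCFA.ShiftsTo (D : DCFA Γ) (t : Trigger arN arT X) (S : Stack arN arT X)
    (g' : List (Lit arT X)) (e : Lit arT X) (h : List (Lit arT X)) : Prop :=
  ∃ S' S_A, D.Move t (S, g') (S', g' ++ [e]) ∧
    D.Moves (S', g' ++ [e]) (S_A, g' ++ e :: h) ∧ D.Accepting S_A

/-- The return value `(t, e)` is useful for the configuration `(S, g')` and the rest graph `g''`. -/
def DCFA.Useful (D : DCFA Γ) (S : Stack arN arT X) (g' g'' : List (Lit arT X))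
    (t : Trigger arN arT X) (e : Lit arT X) : Prop :=
  pseudo (D.top S).1 (D.top S).2 g' (some e) ∈ D.Follow (D.top S).1 t ∧
  ((∃ e' h', (e' :: h').Perm g'' ∧ D.ShiftsTo t S g' e' h') →
    ∃ h, (e :: h).Perm g'' ∧ D.ShiftsTo t S g' e h)

/-- The free edge choice property: in every reached configuration and for every nonempty rest graph
that can still be read to acceptance, every return value of the procedure is useful. -/
def DCFA.FreeEdgeChoice (D : DCFA Γ)
    (seq : State arN arT X → List (Trigger arN arT X)) : Prop :=
  ∀ S g' g'', D.Reached S g' → g'' ≠ [] →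
    (∃ S_A, D.Moves (S, g') (S_A, g' ++ g'') ∧ D.Accepting S_A) →
    ∀ t e, D.SelectTrigger seq (D.top S).1 (D.top S).2 g'' (some (t, some e)) →
      D.Useful S g' g'' t e

end

end PSR

namespace PSR

variable {N T X : Type*} {arN : N → ℕ} {arT : T → ℕ} {Γ : HRGrammar arN arT X}

/-! ### Literals -/

/-! Take the given successful run and let `t₀` be the trigger of its first move, or the accept item
if the run is empty. Then `g''` is a successful graph for `t₀`, so the pseudo-image of its first
literal (or `$`) lies in Follow of `t₀`, and `t₀` would be found applicable by the loop. Hence the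
loop stops at `t₀` or at some earlier trigger `t`. An earlier `t` is impossible. The returned
literal `e` merely fits some pseudo-literal, which need not be its own pseudo-image, but clause (i)
of the free edge choice property puts the pseudo-image of `e` in Follow of `t`. As `e` occurs in
`g''`, that image is also in Follow* of `t₀`, and the ordering makes these two sets disjoint. Thus
`t = t₀` (`SelectTrigger.eq_of_success`). If `t₀` is a reduce item, the given run is already the
required one. If it is a transition, clause (ii) yields a run that shifts `e` first, though possibly
to another accepting stack. Accepting stacks are unique (`Accepting.unique`): the accept item forces
a single step from the initial state under `Z`, and that step introduces no new nodes. Trigger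
sequences exist because a state has finitely many triggers and conflict-freeness makes `≺` acyclic,
so the triggers can be sorted topologically. -/

theorem Lit.map_map {L Y Z W : Type*} {ar : L → ℕ} (f : Y → Z) (g : Z → W) (e : Lit ar Y) :
    (e.map f).map g = e.map (g ∘ f) := rfl

theorem Lit.map_congr {L Y Z : Type*} {ar : L → ℕ} {f g : Y → Z} {e : Lit ar Y}
    (h : ∀ x ∈ e.nodes, f x = g x) : e.map f = e.map g := by
  simp only [Lit.map, Lit.mk.injEq, heq_eq_eq, true_and]
  exact funext fun i => h _ ⟨i, rfl⟩

theorem Lit.map_injective {L Y Z : Type*} {ar : L → ℕ} {f : Y → Z} (hf : f.Injective) :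
    (Lit.map (ar := ar) f).Injective := by
  rintro ⟨a, x⟩ ⟨b, y⟩ h
  simp only [Lit.map, Lit.mk.injEq] at h
  obtain ⟨rfl, h⟩ := h
  have h := eq_of_heq h
  congr
  exact funext fun i => hf (congrFun h i)

theorem Lit.nodes_map {L Y Z : Type*} {ar : L → ℕ} (f : Y → Z) (e : Lit ar Y) :
    (e.map f).nodes = f '' e.nodes := by
  simp [Lit.nodes, Lit.map, ← Set.range_comp, Function.comp_def]

/-- Partial functions that are the identity on the nodes of a literal do not change it. -/
theorem Lit.Inst.eq_of_fixed {L Y : Type*} {ar : L → ℕ} {e e' : Lit ar Y} {σ : Bind Y}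
    (h : e.Inst σ e') (hσ : ∀ x ∈ e.nodes, σ x = some x) : e' = e :=
  Lit.map_injective (Option.some_injective _) (h.symm.trans (Lit.map_congr hσ))

theorem Lit.Inst.exists_apply {L Y : Type*} {ar : L → ℕ} {e e' : Lit ar Y} {σ : Bind Y}
    (h : e.Inst σ e') {y : Y} (hy : y ∈ e'.nodes) : ∃ x ∈ e.nodes, σ x = some y := by
  have hn : some '' e'.nodes = σ '' e.nodes := by
    rw [← Lit.nodes_map, ← Lit.nodes_map, h]
  exact (Set.ext_iff.1 hn (some y)).1 ⟨y, hy, rfl⟩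

theorem Lit.exists_eq_ofT_of_inst {e : Lit (arity arN arT) X} {σ : Bind X} {a : Lit arT X}
    (h : e.Inst σ a.ofT) : ∃ b : Lit arT X, e = b.ofT := by
  obtain ⟨l, x⟩ := e
  have hl : l = Sum.inr a.lab := congrArg Lit.lab h
  subst hl
  exact ⟨⟨a.lab, x⟩, rfl⟩

/-! ### Uniqueness of the accepting stack -/

/-- Closure steps only call rules of the grammar, never the augmenting production. -/
theorem HRGrammar.mem_of_closure_of_prod_none {K : Set (Item arN arT X)} {it : Item arN arT X}
    (h : it ∈ Γ.closure K) (hp : it.prod = none) : it ∈ K := by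
  cases h with
  | base _ h => exact h
  | call => simp at hp

/-- Renaming changes neither production nor dot, and closure adds no such item, so it must come from
moving a dot in the source. Here `σ` is the binding in terms of the transition label, before the
parameters of the target are renamed. -/
theorem DCFA.exists_mem_src_of_prod_none {D : DCFA Γ} {tr : Transition arN arT X}
    (htr : tr ∈ D.trans) {it : Item arN arT X} (hit : it ∈ tr.tgt) (hp : it.prod = none) :
    ∃ it₀ ∈ tr.src, ∃ σ : Bind X, it₀.prod = none ∧ it.pos = it₀.pos + 1 ∧
      (∀ x y, it₀.bind x = some y → σ x = some y) ∧
      ∀ e₀, Γ.next it₀ = some e₀ → e₀.Inst σ tr.lit := by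
  have h : it.rename tr.ren ∈ Γ.closure (Γ.goto tr.src tr.lit) :=
    D.tgt_eq tr htr ▸ ⟨it, hit, rfl⟩
  obtain ⟨it₀, h₀, e₀, he₀, σ, -, -, hσ, -, hi, heq⟩ :=
    HRGrammar.mem_of_closure_of_prod_none h hp
  have h1 := congrArg Item.prod heq
  have h2 := congrArg Item.pos heq
  refine ⟨it₀, h₀, σ, h1.symm.trans hp, h2, hσ, fun e he => ?_⟩
  rw [he₀] at he
  cases he
  exact hi

/-- Consecutive entries of the stack are linked by steps of the automaton. -/
def DCFA.Linked (D : DCFA Γ) : Stack arN arT X → Prop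
  | [] => True
  | p :: S => (∃ W tr, D.Step W (D.top S) tr p.1 p.2) ∧ D.Linked S

theorem DCFA.Linked.of_append {D : DCFA Γ} {P S : Stack arN arT X} (h : D.Linked (P ++ S)) :
    D.Linked S := by
  induction P with
  | nil => exact h
  | cons p P ih => exact ih h.2

/-- Stacks are stored top first, so a reduction pops a prefix and leaves a linked suffix. `Linked`
forgets which nodes had to be avoided; freshness plays no role in the uniqueness argument. -/
theorem DCFA.Move.linked {D : DCFA Γ} {t : Trigger arN arT X} {c c' : Config arN arT X}
    (h : D.Move t c c') (hc : D.Linked c.1) : D.Linked c'.1 := by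
  cases h with
  | shift S g tr e q hs => exact ⟨⟨_, tr, hs⟩, hc⟩
  | reduce S P S' g r σ A tr q _ hS _ _ hs =>
    subst hS
    exact ⟨⟨_, tr, hs⟩, hc.of_append⟩

theorem DCFA.Reached.linked {D : DCFA Γ} {S : Stack arN arT X} {g : List (Lit arT X)}
    (h : D.Reached S g) : D.Linked S := by
  have key : ∀ c, D.Moves ([], []) c → D.Linked c.1 := by
    intro c hc
    induction hc with
    | refl => trivial
    | tail _ hm ih => exact hm.choose_spec.linked ih
  exact key _ h

/-- Trigger orders are only constrained on states of the automaton, so this membership is needed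
before using them. -/
theorem DCFA.Linked.top_mem_states {D : DCFA Γ} {S : Stack arN arT X} (h : D.Linked S) :
    (D.top S).1 ∈ D.states := by
  cases S with
  | nil => exact (D.states_eq _).2 .refl
  | cons p S =>
    obtain ⟨⟨W, tr, htr, -, ht, -⟩, -⟩ := h
    exact (D.states_eq _).2 (((D.states_eq _).1 (D.trans_src tr htr)).tail ⟨tr, htr, rfl, ht⟩)

theorem DCFA.eq_of_mem_init {D : DCFA Γ} {it : Item arN arT X} (h : it ∈ D.init)
    (hp : it.prod = none) : it = ⟨none, 0, Γ.iota⟩ := by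
  have h' : it ∈ Γ.closure {⟨none, 0, Γ.iota⟩} := D.init_eq ▸ h
  exact Set.mem_singleton_iff.1 (HRGrammar.mem_of_closure_of_prod_none h' hp)

/-- Every transition advances the dot of the augmenting production, so dot position 0 occurs only at
the bottom. -/
theorem DCFA.Linked.eq_nil_of_mem_top {D : DCFA Γ} {S : Stack arN arT X} (h : D.Linked S)
    {it : Item arN arT X} (hit : it ∈ (D.top S).1) (hp : it.prod = none) (h0 : it.pos = 0) :
    S = [] := by
  cases S with
  | nil => rfl
  | cons p S =>
    obtain ⟨⟨W, tr, htr, -, ht, -⟩, -⟩ := h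
    have hit' : it ∈ tr.tgt := ht ▸ hit
    obtain ⟨_, _, _, _, hpos, _⟩ := DCFA.exists_mem_src_of_prod_none htr hit' hp
    omega

theorem DCFA.start_nodes_subset_params_init (D : DCFA Γ) :
    Γ.start.nodes ⊆ params (D.init : Set (Item arN arT X)) := by
  intro x hx
  refine ⟨⟨none, 0, Γ.iota⟩, ?_, x, by simp [HRGrammar.iota, hx]⟩
  rw [D.init_eq]
  exact HRGrammar.closure.base _ rfl

/-- A linked accepting stack consists of a single step from the initial state under the start
literal. -/
theorem DCFA.Accepting.exists_step {D : DCFA Γ} {S : Stack arN arT X} (h : D.Linked S)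
    (ha : D.Accepting S) :
    ∃ p W tr, S = [p] ∧ D.Step W (D.init, Γ.iota) tr p.1 p.2 ∧ tr.lit = Γ.start.ofN := by
  obtain ⟨it, hit, hp, h1⟩ := ha
  cases S with
  | nil =>
    have := DCFA.eq_of_mem_init hit hp
    simp [this] at h1
  | cons p S =>
    obtain ⟨⟨W, tr, hs⟩, hl⟩ := h
    have hs' := hs
    obtain ⟨htr, hsrc, ht, -⟩ := hs'
    have hit' : it ∈ tr.tgt := ht ▸ hit
    obtain ⟨it₀, h₀, σ, hp₀, hpos, hσ, hi⟩ := DCFA.exists_mem_src_of_prod_none htr hit' hp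
    rw [hsrc] at h₀
    obtain rfl : S = [] := hl.eq_nil_of_mem_top h₀ hp₀ (by omega)
    obtain rfl := DCFA.eq_of_mem_init h₀ hp₀
    refine ⟨p, W, tr, rfl, hs, (hi Γ.start.ofN rfl).eq_of_fixed fun x hx => hσ x x ?_⟩
    have hx' : x ∈ Γ.start.nodes := hx
    simp [HRGrammar.iota, hx']

theorem SameLabel.refl (Q : State arN arT X) (e : Lit (arity arN arT) X) : SameLabel Q e e :=
  ⟨id, Set.injOn_id _, fun _ _ => rfl, rfl⟩

/-- Both stacks are one step from the same bound state under the label `Z`. Determinism fixes the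
transition, and since all nodes of `Z` are already parameters, the binding leaves no freedom. -/
theorem DCFA.Accepting.unique {D : DCFA Γ} {S S' : Stack arN arT X} (h : D.Linked S)
    (h' : D.Linked S') (ha : D.Accepting S) (ha' : D.Accepting S') : S = S' := by
  obtain ⟨⟨e, Q, τ⟩, W, tr, rfl, ⟨htr, hs, ht, ν, -, hd, hν, -, hi, hτ⟩, hl⟩ := ha.exists_step h
  obtain ⟨⟨e', Q', τ'⟩, W', tr', rfl, ⟨htr', hs', ht', ν', -, hd', hν', -, hi', hτ'⟩, hl'⟩ :=
    ha'.exists_step h'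
  obtain rfl : tr = tr' := D.trans_unique tr htr tr' htr' (hs.trans hs'.symm) (by
    rw [hl, hl']; exact SameLabel.refl _ _)
  have hsub : ∀ x, x ∈ tr.lit.nodes → x ∈ params (D.init : Set (Item arN arT X)) := by
    intro x hx
    rw [hl] at hx
    exact D.start_nodes_subset_params_init hx
  -- Both functions agree with `ι` on the parameters of the initial state, and by `hsub` they are
  -- undefined elsewhere.
  have hνν : ν = ν' := by
    funext x
    by_cases hx : x ∈ params (D.init : Set (Item arN arT X))
    · exact (hν x hx).trans (hν' x hx).symm
    · have hn : ¬ (x ∈ params (D.init : Set (Item arN arT X)) ∨ x ∈ tr.lit.nodes) :=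
        fun h => hx (h.elim id (hsub x))
      have h1 := mt (hd x).1 hn
      have h2 := mt (hd' x).1 hn
      simp only [Option.not_isSome_iff_eq_none] at h1 h2
      rw [h1, h2]
  subst hνν
  have hee : e = e' := Lit.map_injective (Option.some_injective _) (hi.symm.trans hi')
  simp only at ht ht' hτ hτ'
  rw [hee, ← ht, ← ht', hτ, hτ']

/-! ### Existence of trigger sequences -/

/-- Literals to which the same item can be moved have the same label up to new nodes. -/
theorem sameLabel_of_extensions {Q : State arN arT X} {σ σ₁ σ₂ : Bind X}
    {e₀ e₁ e₂ : Lit (arity arN arT) X}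
    (hσ : ∀ x y, σ x = some y → y ∈ params (Q : Set (Item arN arT X)))
    (inj₁ : σ₁.Inj) (inj₂ : σ₂.Inj)
    (ext₁ : ∀ x y, σ x = some y → σ₁ x = some y)
    (ext₂ : ∀ x y, σ x = some y → σ₂ x = some y)
    (new₁ : ∀ x ∈ e₀.nodes, σ x = none → ∀ y, σ₁ x = some y →
      y ∉ params (Q : Set (Item arN arT X)))
    (new₂ : ∀ x ∈ e₀.nodes, σ x = none → ∀ y, σ₂ x = some y →
      y ∉ params (Q : Set (Item arN arT X)))
    (inst₁ : e₀.Inst σ₁ e₁) (inst₂ : e₀.Inst σ₂ e₂) : SameLabel Q e₁ e₂ := by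
  classical
  have total₂ : ∀ x ∈ e₀.nodes, ∃ y, σ₂ x = some y := by
    rintro _ ⟨i, rfl⟩
    have h : σ₂ (e₀.args i) ∈ (e₀.map σ₂).nodes := ⟨i, rfl⟩
    rw [inst₂, Lit.nodes_map] at h
    obtain ⟨y, -, hy⟩ := h
    exact ⟨y, hy.symm⟩
  let P := params (Q : Set (Item arN arT X))
  -- Off the parameters, `ρ` is `σ₂` after the inverse of `σ₁`. The fallback values are never
  -- reached on nodes of `e₁`.
  let ρ : X → X := fun y =>
    if y ∈ P then y
    else if h : ∃ x ∈ e₀.nodes, σ₁ x = some y then (σ₂ h.choose).getD y else y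
  have fix : ∀ y ∈ P, ρ y = y := fun y hy => if_pos hy
  have val : ∀ x ∈ e₀.nodes, ∀ y, σ₁ x = some y → σ₂ x = some (ρ y) := by
    intro x hx y hy
    by_cases hP : y ∈ P
    · rw [fix y hP]
      cases hsx : σ x with
      | none => exact absurd hP (new₁ x hx hsx y hy)
      | some z =>
        have : some z = some y := (ext₁ x z hsx).symm.trans hy
        exact ext₂ x y (hsx.trans this)
    · have h : ∃ x ∈ e₀.nodes, σ₁ x = some y := ⟨x, hx, hy⟩
      have hc : h.choose = x := inj₁ _ _ y h.choose_spec.2 hy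
      obtain ⟨z, hz⟩ := total₂ x hx
      simp only [ρ, if_neg hP, dif_pos h, hc, hz, Option.getD_some]
  -- New nodes go to new nodes, which rules out the mixed cases in the injectivity proof.
  have out : ∀ x ∈ e₀.nodes, ∀ y, σ₁ x = some y → y ∉ P → ρ y ∉ P := by
    intro x hx y hy hyP
    refine new₂ x hx ?_ _ (val x hx y hy)
    cases hsx : σ x with
    | none => rfl
    | some z =>
      have : some z = some y := (ext₁ x z hsx).symm.trans hy
      cases this
      exact absurd (hσ x y hsx) hyP
  refine ⟨ρ, ?_, fix, ?_⟩
  · intro y hy z hz hyz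
    by_cases hyP : y ∈ P <;> by_cases hzP : z ∈ P
    · rwa [fix y hyP, fix z hzP] at hyz
    · obtain ⟨x, hx, hxz⟩ := inst₁.exists_apply (hz.resolve_left hzP)
      exact absurd (by rw [← hyz, fix y hyP]; exact hyP) (out x hx z hxz hzP)
    · obtain ⟨x, hx, hxy⟩ := inst₁.exists_apply (hy.resolve_left hyP)
      exact absurd (by rw [hyz, fix z hzP]; exact hzP) (out x hx y hxy hyP)
    · obtain ⟨x, hx, hxy⟩ := inst₁.exists_apply (hy.resolve_left hyP)
      obtain ⟨x', hx', hxz⟩ := inst₁.exists_apply (hz.resolve_left hzP)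
      have h1 := val x hx y hxy
      have h2 := val x' hx' z hxz
      rw [hyz] at h1
      obtain rfl := inj₂ _ _ _ h1 h2
      exact Option.some_injective _ (hxy.symm.trans hxz)
  · apply Lit.map_injective (Option.some_injective _)
    have h1 : (e₁.map ρ).map some = (e₁.map some).map (Option.map ρ) := rfl
    rw [h1, ← inst₁, ← inst₂, Lit.map_map]
    refine Lit.map_congr fun x hx => ?_
    obtain ⟨y, hy⟩ : ∃ y, σ₁ x = some y := by
      obtain ⟨i, rfl⟩ := hx
      have h : σ₁ (e₀.args i) ∈ (e₀.map σ₁).nodes := ⟨i, rfl⟩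
      rw [inst₁, Lit.nodes_map] at h
      obtain ⟨y, -, hy⟩ := h
      exact ⟨y, hy.symm⟩
    simp [hy, val x hx y hy]

/-- Assign to each transition one item of `Q` whose dot it moves. The item determines the label up
to new nodes, hence the transition, so the assignment embeds the transitions into the finite set
`Q`. -/
theorem DCFA.finite_transitions (D : DCFA Γ) (Q : State arN arT X) :
    {tr ∈ D.trans | tr.src = Q}.Finite := by
  have : Nonempty (Item arN arT X) := ⟨⟨none, 0, fun _ => none⟩⟩
  have key : ∀ tr ∈ {tr ∈ D.trans | tr.src = Q}, ∃ it ∈ Q, ∃ e₀, Γ.next it = some e₀ ∧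
      ∃ σ' : Bind X, σ'.Inj ∧ (∀ x y, it.bind x = some y → σ' x = some y) ∧
      (∀ x ∈ e₀.nodes, it.bind x = none → ∀ y, σ' x = some y →
        y ∉ params (Q : Set (Item arN arT X))) ∧ e₀.Inst σ' tr.lit := by
    rintro tr ⟨htr, rfl⟩
    obtain ⟨_, it, hit, e₀, he, σ', h1, -, h2, h3, h4, -⟩ := D.trans_nonempty tr htr
    exact ⟨it, hit, e₀, he, σ', h1, h2, h3, h4⟩
  choose! F hF using key
  refine Set.Finite.of_finite_image (f := F) (Q.finite_toSet.subset ?_) ?_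
  · rintro _ ⟨tr, htr, rfl⟩
    exact (hF tr htr).1
  · intro tr htr tr' htr' h
    obtain ⟨hit, e₀, he, σ, i1, x1, n1, I1⟩ := hF tr htr
    obtain ⟨-, e₀', he', σ', i2, x2, n2, I2⟩ := hF tr' htr'
    rw [h] at he x1 n1 hit
    obtain rfl : e₀ = e₀' := Option.some_injective _ (he.symm.trans he')
    refine D.trans_unique tr htr.1 tr' htr'.1 (htr.2.trans htr'.2.symm) ?_
    rw [htr.2]
    exact sameLabel_of_extensions (σ := (F tr').bind) (fun x y hy => ⟨_, hit, x, hy⟩)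
      i1 i2 x1 x2 n1 n2 I1 I2

theorem DCFA.finite_triggers (D : DCFA Γ) (Q : State arN arT X) :
    {t | D.IsTrigger Q t}.Finite := by
  refine (((D.finite_transitions Q).image Trigger.shift).union
    (Q.finite_toSet.image Trigger.reduce)).subset ?_
  rintro (tr | it) h
  · exact .inl ⟨tr, ⟨h.1, h.2.1⟩, rfl⟩
  · exact .inr ⟨it, h.1, rfl⟩

/-- A finite set with an acyclic relation can be listed such that no element is related to an
earlier one. -/
theorem exists_list_pairwise_not_of_acyclic {α : Type*} (R : α → α → Prop)
    (hR : ∀ a, ¬ Relation.TransGen R a a) (s : Finset α) :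
    ∃ l : List α, l.Nodup ∧ (∀ a, a ∈ l ↔ a ∈ s) ∧ l.Pairwise fun a b => ¬ R b a := by
  classical
  induction s using Finset.strongInduction with
  | H s ih =>
    rcases s.eq_empty_or_nonempty with rfl | hs
    · exact ⟨[], by simp⟩
    -- Acyclicity makes the transitive closure a strict order; a minimal element of the finite set
    -- is listed first.
    · let hI : IsStrictOrder α (Relation.TransGen R) :=
        { irrefl := hR, trans := fun _ _ _ => Relation.TransGen.trans }
      obtain ⟨m, hm, hmin⟩ := (s.finite_toSet.wellFoundedOn (r := Relation.TransGen R)).has_min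
        Set.univ ⟨⟨hs.choose, hs.choose_spec⟩, trivial⟩
      obtain ⟨l, hl, hmem, hp⟩ := ih (s.erase m) (Finset.erase_ssubset m.2)
      refine ⟨m :: l, List.nodup_cons.2 ⟨by simp [hmem], hl⟩, fun a => ?_,
        List.pairwise_cons.2 ⟨fun b hb hRb => ?_, hp⟩⟩
      · by_cases ha : a = m
        · subst ha; simp
        · simp [hmem, ha]
      · exact hmin ⟨b, Finset.mem_of_mem_erase ((hmem b).1 hb)⟩ trivial (.single hRb)

theorem exists_isChain_of_transGen {α : Type*} {R : α → α → Prop} {a b : α}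
    (h : Relation.TransGen R a b) : ∃ l, List.IsChain R (a :: l ++ [b]) := by
  induction h using Relation.TransGen.head_induction_on with
  | single h => exact ⟨[], by simpa using h⟩
  | @head a c h _ ih =>
    obtain ⟨l, hl⟩ := ih
    exact ⟨c :: l, by simpa using ⟨h, hl⟩⟩

/-- Each element before the last is the left side of some related pair. This shows that a cycle of
`≺` consists of triggers. -/
theorem List.IsChain.forall_mem_of_left {α : Type*} {R : α → α → Prop} {p : α → Prop}
    (hR : ∀ a b, R a b → p a) {l : List α} {b : α} (h : List.IsChain R (l ++ [b])) :
    ∀ a ∈ l, p a := by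
  induction l with
  | nil => simp
  | cons c l ih =>
    intro a ha
    rcases List.mem_cons.1 ha with rfl | ha
    · cases l with
      | nil => exact hR _ b (by simpa using h)
      | cons d l => exact hR _ d (by simp at h; exact h.1)
    · exact ih (by simpa using h.tail) a ha

theorem DCFA.ConflictFree.acyclic {D : DCFA Γ} {Q : State arN arT X} (h : D.ConflictFree Q)
    (t : Trigger arN arT X) : ¬ Relation.TransGen (D.Prec Q) t t := by
  intro ht
  obtain ⟨ts, hts⟩ := exists_isChain_of_transGen ht
  exact h ⟨_, List.IsChain.forall_mem_of_left (fun _ _ h => h.1) hts, t, ts, rfl, hts⟩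

theorem DCFA.ConflictFree.exists_isTriggerSeq {D : DCFA Γ} {Q : State arN arT X}
    (h : D.ConflictFree Q) : ∃ ts, D.IsTriggerSeq Q ts := by
  obtain ⟨l, hl, hm, hp⟩ :=
    exists_list_pairwise_not_of_acyclic (D.Prec Q) h.acyclic (D.finite_triggers Q).toFinset
  have hm' : ∀ t, t ∈ l ↔ D.IsTrigger Q t := fun t => by simp [hm]
  -- `Nodup` is pairwise distinctness, which supplies the inequality that `Prec` demands.
  refine ⟨l, hl, hm', (hp.and hl).imp_of_mem fun {a b} ha hb hab => ?_⟩
  rw [Set.inter_comm]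
  by_contra hne
  exact hab.1 ⟨(hm' b).1 hb, (hm' a).1 ha, hab.2.symm, Set.nonempty_iff_ne_empty.2 hne⟩

/-! ### The loop of the procedure -/

/-- Failure counts as a result here; it is excluded separately, by exhibiting an applicable trigger.
-/
theorem DCFA.Loop.exists_result (D : DCFA Γ) (Q : State arN arT X) (τ : Bind X)
    (g : List (Lit arT X)) (ts : List (Trigger arN arT X)) : ∃ r, D.Loop Q τ g ts r := by
  induction ts with
  | nil => exact ⟨_, .failure⟩
  | cons t ts ih =>
    obtain ⟨r, hr⟩ := ih
    by_cases h1 : g ≠ [] ∧ ∃ l, some l ∈ D.Follow Q t ∧ ∃ e ∈ g, Fits Q τ e l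
    · obtain ⟨hg, l, hl, e, he, hf⟩ := h1
      exact ⟨_, .found t ts l e hg hl he hf⟩
    · by_cases h2 : g = [] ∧ none ∈ D.Follow Q t
      · exact ⟨_, .eoi t ts h2.1 h2.2⟩
      · exact ⟨r, .next t ts r (fun hg h => h1 ⟨hg, h⟩) (fun hg h => h2 ⟨hg, h⟩) hr⟩

/-- If some trigger in the list is applicable, the loop returns a trigger that does not occur later
in the list. -/
theorem DCFA.Loop.exists_of_applicable {D : DCFA Γ} {Q : State arN arT X} {τ : Bind X}
    {g : List (Lit arT X)} {ts : List (Trigger arN arT X)}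
    {r : Option (Trigger arN arT X × Option (Lit arT X))} (h : D.Loop Q τ g ts r)
    (hp : ts.Pairwise fun t t' => D.Follow Q t ∩ D.FollowStar Q t' = ∅)
    {t₀ : Trigger arN arT X} (ht₀ : t₀ ∈ ts)
    (hne : g ≠ [] → ∃ l, some l ∈ D.Follow Q t₀ ∧ ∃ e ∈ g, Fits Q τ e l)
    (hnil : g = [] → none ∈ D.Follow Q t₀) :
    ∃ t e, r = some (t, e) ∧ (g = [] ↔ e = none) ∧ (∀ a, e = some a → a ∈ g) ∧
      (g = [] → none ∈ D.Follow Q t) ∧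
      (t = t₀ ∨ D.Follow Q t ∩ D.FollowStar Q t₀ = ∅) := by
  induction h with
  | failure => simp at ht₀
  | found t ts l e hg hl he hf =>
    refine ⟨t, some e, rfl, by simp [hg], by simp [he], fun h => absurd h hg, ?_⟩
    rcases List.mem_cons.1 ht₀ with h | h
    · exact .inl h.symm
    · exact .inr ((List.pairwise_cons.1 hp).1 _ h)
  | eoi t ts hg hl =>
    refine ⟨t, none, rfl, by simp [hg], by simp, fun _ => hl, ?_⟩
    rcases List.mem_cons.1 ht₀ with h | h
    · exact .inl h.symm
    · exact .inr ((List.pairwise_cons.1 hp).1 _ h)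
  | next t ts r h1 h2 _ ih =>
    rcases List.mem_cons.1 ht₀ with rfl | h
    -- The loop cannot pass over `t₀`, which is applicable.
    · by_cases hg : g = []
      · exact absurd (hnil hg) (h2 hg)
      · exact absurd (hne hg) (h1 hg)
    · exact ih (List.pairwise_cons.1 hp).2 h

theorem fits_map_pnode (Q : State arN arT X) (τ : Bind X) (g : List (Lit arT X)) (e : Lit arT X) :
    Fits Q τ e (e.map (pnode Q τ g)) := by
  refine ⟨e.lab, e.args, _, rfl, rfl, fun i p _ hi => ?_⟩
  unfold pnode at hi
  split_ifs at hi with h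
  cases hi
  exact h.choose_spec.2

/-! ### Correctness of the selected trigger -/

theorem DCFA.Move.isTrigger {D : DCFA Γ} {t : Trigger arN arT X} {c c' : Config arN arT X}
    (h : D.Move t c c') : D.IsTrigger (D.top c.1).1 t := by
  cases h with
  | shift S g tr e q hs =>
    obtain ⟨htr, hsrc, -, ν, -, -, -, -, hi, -⟩ := hs
    exact ⟨htr, hsrc, Lit.exists_eq_ofT_of_inst hi⟩
  | reduce S P S' g r σ A tr q hit => exact ⟨hit, rfl⟩

/-- Used to identify the literal read by the first shift with the head of the rest graph. -/
theorem DCFA.Moves.exists_append {D : DCFA Γ} {c c' : Config arN arT X} (h : D.Moves c c') :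
    ∃ v, c'.2 = c.2 ++ v := by
  induction h with
  | refl => exact ⟨[], by simp⟩
  | tail _ hm ih =>
    obtain ⟨v, hv⟩ := ih
    obtain ⟨t, hm⟩ := hm
    cases hm with
    | shift S g tr e q hs => exact ⟨v ++ [e], by simp at hv; simp [hv]⟩
    | reduce => exact ⟨v, hv⟩

/-- A result of the procedure is the trigger of any given successful sequence. -/
theorem DCFA.SelectTrigger.eq_of_success {D : DCFA Γ}
    {seq : State arN arT X → List (Trigger arN arT X)} (hseq : D.IsTriggerOrder seq)
    (hfree : D.FreeEdgeChoice seq) {S S_A : Stack arN arT X} {g' g'' : List (Lit arT X)}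
    (hr : D.Reached S g') (hm : D.Moves (S, g') (S_A, g' ++ g'')) (ha : D.Accepting S_A)
    {t₀ : Trigger arN arT X} (ht₀ : g'' ∈ D.Success (D.top S).1 (D.top S).2 g' t₀)
    {r : Option (Trigger arN arT X × Option (Lit arT X))}
    (hsel : D.SelectTrigger seq (D.top S).1 (D.top S).2 g'' r) :
    ∃ e, r = some (t₀, e) ∧ (g'' = [] ↔ e = none) ∧
      ∀ a, e = some a → a ∈ g'' ∧ D.Useful S g' g'' t₀ a := by
  obtain ⟨-, hts, hpw⟩ := hseq _ hr.linked.top_mem_states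
  have htrig : D.IsTrigger (D.top S).1 t₀ := ht₀.choose_spec.2.2.1
  have hfol : pseudo (D.top S).1 (D.top S).2 g' (first g'') ∈ D.Follow (D.top S).1 t₀ :=
    ⟨_, _, _, ht₀, rfl⟩
  obtain ⟨t, e, rfl, hiff, hmem, hnone, hor⟩ := hsel.exists_of_applicable hpw ((hts t₀).2 htrig)
    (by
      intro hne
      obtain ⟨a, h, rfl⟩ := List.exists_cons_of_ne_nil hne
      exact ⟨_, hfol, a, by simp, fits_map_pnode _ _ _ _⟩)
    (by rintro rfl; exact hfol)
  have huse : ∀ a, e = some a → D.Useful S g' g'' t a := by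
    rintro a rfl
    exact hfree S g' g'' hr (by simpa using hiff) ⟨S_A, hm, ha⟩ t a hsel
  obtain rfl : t = t₀ := by
    refine hor.resolve_right fun hempty => ?_
    -- One pseudo-image witnesses both memberships: in Follow of `t` by free edge choice, or by the
    -- end-of-input test for `$`; in Follow* of `t₀` because `g''` is successful for `t₀`.
    suffices h : pseudo (D.top S).1 (D.top S).2 g' e ∈
        D.Follow (D.top S).1 t ∩ D.FollowStar (D.top S).1 t₀ by
      rw [hempty] at h
      exact h
    cases e with
    | none => exact ⟨hnone (hiff.2 rfl), _, _, _, ht₀, none, .inl ⟨hiff.2 rfl, rfl⟩, rfl⟩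
    | some a =>
      exact ⟨(huse a rfl).1, _, _, _, ht₀, some a, .inr ⟨a, hmem a rfl, rfl⟩, rfl⟩
  exact ⟨e, rfl, hiff, fun a h => ⟨hmem a h, huse a h⟩⟩

end PSR

theorem mainTheorem3 {N T X : Type*} [Finite N] [Finite T] [Countable X] [Infinite X]
    {arN : N → ℕ} {arT : T → ℕ} (Γ : PSR.HRGrammar arN arT X) (D : PSR.DCFA Γ)
    (hconf : ∀ Q ∈ D.states, D.ConflictFree Q) :
    (∃ seq, D.IsTriggerOrder seq) ∧
    ∀ seq, D.IsTriggerOrder seq → D.FreeEdgeChoice seq →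
    ∀ (S : PSR.Stack arN arT X) (g' : List (PSR.Lit arT X)) (Q : PSR.State arN arT X)
      (τ : PSR.Bind X), D.Reached S g' → D.top S = (Q, τ) →
    ∀ (g'' : List (PSR.Lit arT X)) (S_A : PSR.Stack arN arT X),
      D.Moves (S, g') (S_A, g' ++ g'') → D.Accepting S_A →
    (∃ r, D.SelectTrigger seq Q τ g'' r) ∧
    ∀ r, D.SelectTrigger seq Q τ g'' r →
      ∃ t e, r = some (t, e) ∧ D.IsTrigger Q t ∧
        (∀ it, t = .reduce it → it.IsAccept → S = S_A ∧ e = none ∧ g'' = []) ∧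
        (∀ it, t = .reduce it → ¬ it.IsAccept →
          (∃ S', D.Move t (S, g') (S', g') ∧ D.Moves (S', g') (S_A, g' ++ g'')) ∧
          (g'' = [] ↔ e = none)) ∧
        (∀ tr, t = .shift tr →
          ∃ a q h, e = some a ∧ a ∈ g'' ∧ g''.Perm (a :: h) ∧
            D.Move t (S, g') ((a.ofT, q) :: S, g' ++ [a]) ∧
            D.Moves ((a.ofT, q) :: S, g' ++ [a]) (S_A, g' ++ a :: h)) := by
  refine ⟨?_, ?_⟩
  · choose! seq h using fun Q hQ => (hconf Q hQ).exists_isTriggerSeq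
    exact ⟨seq, h⟩
  intro seq hseq hfree S g' Q τ hr htop g'' S_A hm ha
  obtain ⟨rfl, rfl⟩ : (D.top S).1 = Q ∧ (D.top S).2 = τ := by simp [htop]
  refine ⟨PSR.DCFA.Loop.exists_result _ _ _ _ _, fun r hsel => ?_⟩
  -- An empty run means that `S` itself is accepting, with the accept item as trigger; otherwise the
  -- first move supplies the trigger.
  rcases Relation.ReflTransGen.cases_head hm with heq | ⟨c, ⟨t₀, hmv⟩, hc⟩
  · obtain ⟨rfl, hg⟩ := Prod.mk.inj heq
    obtain rfl : g'' = [] := by simpa using hg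
    obtain ⟨it, hit, hacc⟩ := ha
    have htrig : D.IsTrigger (D.top S).1 (.reduce it) :=
      ⟨hit, by rw [hacc.1, hacc.2]; rfl⟩
    obtain ⟨e, rfl, hiff, -⟩ := hsel.eq_of_success hseq hfree hr hm ⟨it, hit, hacc⟩
      (t₀ := .reduce it) ⟨S, hr, rfl, htrig, .inl ⟨it, rfl, hacc, rfl⟩⟩
    refine ⟨_, e, rfl, htrig, fun _ _ _ => ⟨rfl, hiff.1 rfl, rfl⟩, ?_, fun _ h => by cases h⟩
    intro it' h hn
    cases h
    exact absurd hacc hn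
  · obtain ⟨e, rfl, hiff, huse⟩ := hsel.eq_of_success hseq hfree hr hm ha
      ⟨S, hr, rfl, hmv.isTrigger, .inr ⟨c, S_A, hmv, hc, ha⟩⟩
    refine ⟨t₀, e, rfl, hmv.isTrigger, ?_, ?_, ?_⟩
    · rintro it rfl hacc
      cases hmv
      -- Reduce moves use rules of the grammar only, so the accept item causes none.
      exact absurd hacc.1 (by simp)
    · rintro it rfl -
      refine ⟨?_, hiff⟩
      cases hmv
      exact ⟨_, .reduce _ _ _ _ _ _ _ _ _ ‹_› ‹_› ‹_› ‹_› ‹_›, hc⟩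
    · rintro tr rfl
      obtain ⟨a₀, h₀, rfl, hsh⟩ : ∃ a₀ h₀, g'' = a₀ :: h₀ ∧ D.ShiftsTo (.shift tr) S g' a₀ h₀ := by
        obtain ⟨v, hv⟩ := PSR.DCFA.Moves.exists_append hc
        cases hmv with
        | shift _ _ _ a q hs =>
          obtain rfl : g'' = a :: v := by simpa using hv
          exact ⟨a, v, rfl, _, S_A, .shift _ _ _ _ _ hs, hc, ha⟩
      cases e with
      | none => simp at hiff
      | some a =>
        obtain ⟨hmem, -, hU⟩ := huse a rfl
        -- The given run, which shifts `a₀`, meets the premise of clause (ii) with the identity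
        -- permutation.
        obtain ⟨h, hperm, S', S_A', hmv', hms, ha'⟩ := hU ⟨a₀, h₀, .refl _, hsh⟩
        have hr' : D.Reached S_A' (g' ++ a :: h) :=
          Relation.ReflTransGen.trans (hr.tail ⟨_, hmv'⟩) hms
        have hr_A : D.Reached S_A (g' ++ a₀ :: h₀) := Relation.ReflTransGen.trans hr hm
        obtain rfl := ha.unique hr_A.linked hr'.linked ha'
        obtain ⟨q, rfl⟩ : ∃ q, S' = (a.ofT, q) :: S := by
          -- The processed graph must be a variable for the case analysis on the move to go through.
          generalize hg : g' ++ [a] = k at hmv'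
          cases hmv' with
          | shift _ _ _ b q hs =>
            obtain rfl : a = b := by simpa using hg
            exact ⟨q, rfl⟩
        exact ⟨a, q, h, rfl, hmem, hperm.symm, hmv', hms⟩
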